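/- Consider partitions whose parts are positive integers coloured with one of the three colours $1,2,3$ (the order among equal parts of different colours being immaterial), in which all parts of colour $1$ or $3$ are even and all parts of colour $2$ are odd. For such a coloured partition $\lambda$ let $f_i^{(c)}$ be the number of parts of size $i$ and colour $c$, let $l(\lambda)$ be the number of parts and $|\lambda|$ the sum of all parts. Given nonnegative integers $k_0,k_1,k_2$, put $f_0^{(1)}:=k_0$, $f_{-1}^{(2)}:=k_1$, $f_0^{(3)}:=k_2$, and let $\mathscr{D}_{k_0,k_1,k_2}$ be the set of those $\lambda$ for which \[ f_{i_1}^{(1)}+f_{i_2}^{(2)}+f_{i_3}^{(3)}\leq k_0+k_1+k_2 \] for all integers $i_1,i_3\geq 0$ even and $i_2\geq -1$ odd such that $|i_1-i_2|=|i_2-i_3|=1$. Define the formal power series \[ \mathcal{D}^{(2)}_{k_0\Lambda_0+k_1\Lambda_1+k_2\Lambda_2}(z,q):=\sum_{\lambda\in\mathscr{D}_{k_0,k_1,k_2}} z^{l(\lambda)}q^{|\lambda|}. \] For $d\ge 1$ and $m\in\mathbb{Z}$ let $(q^d;q^d)_m:=\prod_{j=1}^m(1-q^{dj})$ if $m\geq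 0$, and $1/(q^d;q^d)_m:=0$ if $m<0$. **Theorem.** As formal power series in $z$ and $q$, \begin{align*} \mathcal{D}^{(2)}_{2\Lambda_0}(z,q)&= \sum_{r_1,r_2,s_1,s_2\geq 0}\, \prod_{i=1}^2 \frac{z^{r_i+s_i}q^{(r_i+s_i)^2+s_i^2+r_i+2s_i}} {(q;q)_{r_i-r_{i+1}}(q^2;q^2)_{s_i-s_{i-1}}}, \\ \mathcal{D}^{(2)}_{2\Lambda_1}(z,q)&= \sum_{r_1,r_2,s_1,s_2\geq 0}\, \prod_{i=1}^2 \frac{z^{r_i+s_i} q^{(r_i+s_i)^2+s_i^2}} {(q;q)_{r_i-r_{i+1}}(q^2;q^2)_{s_i-s_{i-1}}}, \\ \mathcal{D}^{(2)}_{\Lambda_0+\Lambda_1}(z,q)&= \sum_{r_1,r_2,s_1,s_2\geq 0}\, \bigg(\prod_{i=1}^2 \frac{z^{r_i+s_i} q^{(r_i+s_i)^2+s_i^2+\delta_{i,2}(r_i+2s_i)}} {(q;q)_{r_i-r_{i+1}}(q^2;q^2)_{s_i-s_{i-1}}}\bigg) \Big(1+zq^{2+r_1+r_2+2s_1+2s_2}\Big),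 \\ \mathcal{D}^{(2)}_{\Lambda_0+\Lambda_2}(z,q)&= \sum_{r_1,r_2,s_1,s_2\geq 0}\, \bigg(\prod_{i=1}^2 \frac{z^{r_i+s_i} q^{(r_i+s_i)^2+s_i^2+r_i+2\delta_{i,2}s_i}} {(q;q)_{r_i-r_{i+1}}(q^2;q^2)_{s_i-s_{i-1}}}\bigg) \Big(1+zq^{2+r_1+r_2+2s_1+2s_2}\Big), \end{align*} where $r_3=s_0:=0$ and $\delta_{i,j}$ is the Kronecker delta. -/

import Mathlib

open scoped PowerSeries PowerSeries.WithPiTopology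

/-- A partition whose parts carry one of `m` colours: `freq (c, i)` is the number of parts of
size `i` and colour `c`. The colours `0, …, m - 1` stand for the colour labels `1, …, m`; there are
only finitely many parts, and all of them are positive. -/
@[ext]
structure ColouredPartition (m : ℕ) where
  freq : Fin m × ℕ →₀ ℕ
  freq_zero : ∀ c, freq (c, 0) = 0

namespace ColouredPartition

/-- The number `l(λ)` of parts. -/
def length {m : ℕ} (p : ColouredPartition m) : ℕ := p.freq.sum fun _ f => f

/-- The sum `|λ|` of all parts. -/
def size {m : ℕ} (p : ColouredPartition m) : ℕ := p.freq.sum fun a f => a.2 * f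

end ColouredPartition

/-- The entry `f_i^{(c+1)}` (`i ≥ -1`) of the frequency array, including the boundary entries
`f_{-1}^{(2j)} = k_j` for `1 ≤ j ≤ n - 1` and
`f_0^{(2j-1)} = k_0 δ_{j,1} + k_n δ_{j,n}` for `1 ≤ j ≤ n`.
Only the entries for which `i` plus the colour label is odd belong to the array. -/
def arrayEntry {n : ℕ} (k : Fin (n + 1) → ℕ) (p : ColouredPartition (2 * n - 1))
    (c : Fin (2 * n - 1)) (i : ℤ) : ℕ :=
  if i = -1 then k (Fin.ofNat (n + 1) ((c.val + 1) / 2))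
  else if i = 0 then
    (if c.val = 0 then k 0 else 0) + (if c.val + 1 = 2 * n - 1 then k (Fin.last n) else 0)
  else p.freq (c, i.toNat)

/-- The index sequences `(i_1, …, i_{2n-1})` of the paths on the frequency array: one column index
per row, lying in the array, with consecutive indices differing by `1`. -/
structure IsPath {n : ℕ} (i : Fin (2 * n - 1) → ℤ) : Prop where
  neg_one_le : ∀ c, -1 ≤ i c
  odd : ∀ c, Odd (i c + ((c.val : ℤ) + 1))
  step : ∀ c d : Fin (2 * n - 1), c.val + 1 = d.val → |i c - i d| = 1

/-- The set `𝒟_{k_0, …, k_n}` (`n ≥ 1`) of admissible partitions in `2n - 1` colours: parts with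
an even (odd) colour label are odd (even), and along every path of the frequency array the entries
add up to at most `k_0 + ⋯ + k_n`. -/
def dPartitions (n : ℕ) (k : Fin (n + 1) → ℕ) : Set (ColouredPartition (2 * n - 1)) :=
  {p | (∀ c i, p.freq (c, i) ≠ 0 → Odd (i + (c.val + 1))) ∧
    ∀ i : Fin (2 * n - 1) → ℤ, IsPath i → ∑ c, arrayEntry k p c (i c) ≤ ∑ j, k j}

/-- The generating function `∑_{λ ∈ 𝒟_{k_0, …, k_n}} z^{l(λ)} q^{|λ|}`, as a power series in `z`
whose coefficients are power series in `q`. -/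
noncomputable def dGenFun (n : ℕ) (k : Fin (n + 1) → ℕ) : ℤ⟦X⟧⟦X⟧ :=
  PowerSeries.mk fun l => PowerSeries.mk fun N =>
    (({p ∈ dPartitions n k | p.length = l ∧ p.size = N}.ncard : ℕ) : ℤ)

/-- The variable `z`. -/
noncomputable def zVar : ℤ⟦X⟧⟦X⟧ := PowerSeries.X

/-- The variable `q`. -/
noncomputable def qVar : ℤ⟦X⟧⟦X⟧ := PowerSeries.C PowerSeries.X

/-- `(q^d; q^d)_m = (1 - q^d) (1 - q^{2d}) ⋯ (1 - q^{md})`. -/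
noncomputable def qPoch (d m : ℕ) : ℤ⟦X⟧ :=
  ∏ j ∈ Finset.range m, (1 - PowerSeries.X ^ (d * (j + 1)))

/-- `1 / (q^d; q^d)_m` for an integer `m`, which vanishes for `m < 0`. -/
noncomputable def invQPoch (d : ℕ) (m : ℤ) : ℤ⟦X⟧ :=
  if m < 0 then 0 else PowerSeries.invOfUnit (qPoch d m.toNat) 1

/-- The factor `z^{r+s} q^{(r+s)^2+s^2+e} / ((q;q)_{a} (q^2;q^2)_{b})` of the multisums. -/
noncomputable def multisumFactor (r s e : ℕ) (a b : ℤ) : ℤ⟦X⟧⟦X⟧ :=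
  zVar ^ (r + s) * qVar ^ ((r + s) ^ 2 + s ^ 2 + e) *
    PowerSeries.C (invQPoch 1 a) * PowerSeries.C (invQPoch 2 b)

theorem qPoch_mul_invQPoch {d : ℕ} (hd : 0 < d) (m : ℕ) :
    qPoch d m * invQPoch d m = 1 := by
  have h : ¬ ((m : ℤ) < 0) := by omega
  rw [invQPoch, if_neg h, Int.toNat_natCast]
  refine PowerSeries.mul_invOfUnit _ _ ?_
  simp only [qPoch, map_prod, map_sub, map_one, map_pow, PowerSeries.constantCoeff_X, Units.val_one]
  refine Finset.prod_eq_one fun j _ => ?_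
  rw [zero_pow (by positivity), sub_zero]

/-- The sets counted in the generating function are finite. -/
theorem finite_size_eq (m N : ℕ) : {p : ColouredPartition m | p.size = N}.Finite := by
  have hle : ∀ p : ColouredPartition m, p.size = N → ∀ a : Fin m × ℕ, a.2 * p.freq a ≤ N := by
    intro p hp a
    by_cases ha : p.freq a = 0
    · simp [ha]
    · rw [← hp]
      exact Finset.single_le_sum (f := fun a => a.2 * p.freq a) (fun _ _ => Nat.zero_le _)
        (Finsupp.mem_support_iff.mpr ha)
  refine Set.Finite.of_injOn (t := (Set.univ : Set (Fin m × Fin (N + 1) → Fin (N + 1))))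
    (f := fun p a => Fin.ofNat (N + 1) (p.freq (a.1, a.2.val))) (fun _ _ => Set.mem_univ _)
    ?_ Set.finite_univ
  intro p hp p' hp' h
  have key : ∀ p : ColouredPartition m, p.size = N → ∀ c i, i ≠ 0 →
      p.freq (c, i) ≤ N ∧ (N < i → p.freq (c, i) = 0) := by
    intro p hp c i hi
    have h1 := hle p hp (c, i)
    simp only at h1
    refine ⟨le_trans (Nat.le_mul_of_pos_left _ (Nat.pos_of_ne_zero hi)) h1, fun hN => ?_⟩
    by_contra h0
    have := Nat.le_mul_of_pos_right i (Nat.pos_of_ne_zero h0)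
    omega
  apply ColouredPartition.ext
  ext ⟨c, i⟩
  rcases Nat.eq_zero_or_pos i with rfl | hi
  · rw [p.freq_zero, p'.freq_zero]
  · obtain ⟨h1, h2⟩ := key p hp c i hi.ne'
    obtain ⟨h3, h4⟩ := key p' hp' c i hi.ne'
    by_cases hN : N < i
    · rw [h2 hN, h4 hN]
    · have := congrArg Fin.val (congrFun h (c, ⟨i, by omega⟩))
      simp only [Fin.ofNat] at this
      rwa [Nat.mod_eq_of_lt (by omega), Nat.mod_eq_of_lt (by omega)] at this

/-- `dGenFun n k` is the sum of `z^{l(λ)} q^{|λ|}` over `𝒟_{k_0, …, k_n}`. -/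
theorem hasSum_dGenFun (n : ℕ) (k : Fin (n + 1) → ℕ) :
    HasSum (fun p : dPartitions n k => zVar ^ p.val.length * qVar ^ p.val.size) (dGenFun n k) := by
  classical
  rw [PowerSeries.WithPiTopology.hasSum_iff_hasSum_coeff]
  intro l
  rw [PowerSeries.WithPiTopology.hasSum_iff_hasSum_coeff]
  intro N
  have hfin : {p : dPartitions n k | p.val.length = l ∧ p.val.size = N}.Finite := by
    refine Set.Finite.of_injOn (f := Subtype.val) (fun p hp => hp.2)
      Subtype.val_injective.injOn (finite_size_eq (2 * n - 1) N)
  have hterm : ∀ p : dPartitions n k, PowerSeries.coeff N (PowerSeries.coeff l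
      (zVar ^ p.val.length * qVar ^ p.val.size)) =
      if p.val.length = l ∧ p.val.size = N then 1 else 0 := by
    intro p
    rw [zVar, qVar, ← map_pow, PowerSeries.coeff_mul_C, PowerSeries.coeff_X_pow]
    by_cases h : l = p.val.length
    · simp [h, PowerSeries.coeff_X_pow, eq_comm]
    · simp [h, Ne.symm h]
  have hcard : PowerSeries.coeff N (PowerSeries.coeff l (dGenFun n k)) =
      ∑ p ∈ hfin.toFinset, PowerSeries.coeff N (PowerSeries.coeff l
        (zVar ^ p.val.length * qVar ^ p.val.size)) := by
    rw [Finset.sum_congr rfl fun p hp => (hterm p).trans (if_pos (hfin.mem_toFinset.mp hp))]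
    rw [dGenFun, PowerSeries.coeff_mk, PowerSeries.coeff_mk, Finset.sum_const, nsmul_one,
      ← Set.ncard_eq_toFinset_card _ hfin,
      ← Set.ncard_image_of_injective _ Subtype.val_injective]
    congr 2
    ext p
    constructor
    · rintro ⟨h1, h2⟩
      exact ⟨⟨p, h1⟩, h2, rfl⟩
    · rintro ⟨p', h2, rfl⟩
      exact ⟨p'.2, h2⟩
  rw [hcard]
  refine hasSum_sum_of_ne_finset_zero fun p hp => ?_
  rw [hterm, if_neg]
  exact fun h => hp (hfin.mem_toFinset.mpr h)

/-!
Recording how many parts `1` and `2` a partition in `𝒟_{k₀, k₁, k₂}` has, and decreasing the other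
parts by `2`, moves the frequency array by two columns: the numbers of parts `2` become boundary
entries of a new weight of the same level. Hence the generating functions of a fixed level satisfy
a linear system relating their values at `z` to their values at `z q²`. Modulo `z` only the weight
`(0, K, 0)` contributes to the right-hand side, so a solution is determined by its constant
coefficient there. After the substitution `r₁ = m₁ + m₂`, `r₂ = m₂`, `s₁ = n₁`, `s₂ = n₁ + n₂` the
multisums become Nahm sums; replacing `z` by `z q²` shifts their linear terms, and the contiguity
relations coming from `1 - q^(d m)` cancelling the last factor of `(q^d; q^d)_m` show that they
solve the system at level `2`.
-/

theorem rescale_C {R : Type*} [CommSemiring R] (a b : R) :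
    PowerSeries.rescale a (PowerSeries.C b) = PowerSeries.C b := by
  ext n
  rw [PowerSeries.coeff_rescale, PowerSeries.coeff_C]
  split_ifs with hn
  · rw [hn, pow_zero, one_mul]
  · rw [mul_zero]

theorem rescale_zVar (k : ℕ) :
    PowerSeries.rescale (PowerSeries.X ^ k : ℤ⟦X⟧) zVar = zVar * qVar ^ k := by
  rw [zVar, PowerSeries.rescale_X, qVar, map_pow, mul_comm]

theorem rescale_qVar (a : ℤ⟦X⟧) : PowerSeries.rescale a qVar = qVar :=
  rescale_C a _

theorem hasSum_rescale {R β : Type*} [CommSemiring R] [TopologicalSpace R]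
    [IsTopologicalSemiring R] (a : R) {f : β → R⟦X⟧} {g : R⟦X⟧} (h : HasSum f g) :
    HasSum (fun i => PowerSeries.rescale a (f i)) (PowerSeries.rescale a g) := by
  rw [PowerSeries.WithPiTopology.hasSum_iff_hasSum_coeff] at h ⊢
  intro l
  simpa only [PowerSeries.coeff_rescale] using (h l).mul_left (a ^ l)

theorem invQPoch_of_neg (d : ℕ) {m : ℤ} (hm : m < 0) : invQPoch d m = 0 :=
  if_pos hm

theorem invQPoch_zero (d : ℕ) : invQPoch d 0 = 1 := by
  simpa [invQPoch, qPoch] using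
    PowerSeries.mul_invOfUnit (1 : ℤ⟦X⟧) 1 (by rw [map_one, Units.val_one])

theorem one_sub_mul_invQPoch_succ {d : ℕ} (hd : 0 < d) (m : ℕ) :
    (1 - PowerSeries.X ^ (d * (m + 1))) * invQPoch d (m + 1 : ℕ) = invQPoch d m := by
  have h : qPoch d m * ((1 - PowerSeries.X ^ (d * (m + 1))) * invQPoch d (m + 1 : ℕ)) = 1 := by
    rw [← mul_assoc, qPoch, ← Finset.prod_range_succ, ← qPoch, qPoch_mul_invQPoch hd]
  rw [← left_inv_eq_right_inv ((mul_comm _ _).trans (qPoch_mul_invQPoch hd m)) h]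

section NahmSum

variable {ι : Type*} [Fintype ι]

/-- The summand `z^(w·m) q^(mᵀAm + c·m) / ∏ i, (q^(d i); q^(d i))_(m i)` of the Nahm sum with
quadratic form `A`, bases `q^(d i)`, weights `w` and linear term `c`. -/
noncomputable def nahmTerm (A : Matrix ι ι ℕ) (d w c m : ι → ℕ) : ℤ⟦X⟧⟦X⟧ :=
  zVar ^ (w ⬝ᵥ m) * qVar ^ (m ⬝ᵥ A.mulVec m + c ⬝ᵥ m) *
    PowerSeries.C (∏ i, invQPoch (d i) (m i))

/-- The Nahm sum `∑ m, z^(w·m) q^(mᵀAm + c·m) / ∏ i, (q^(d i); q^(d i))_(m i)`, in the notation of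
`nahmTerm`. It converges when all weights are positive. -/
noncomputable def nahmSum (A : Matrix ι ι ℕ) (d w c : ι → ℕ) : ℤ⟦X⟧⟦X⟧ :=
  ∑' m, nahmTerm A d w c m

variable {A : Matrix ι ι ℕ} {d w : ι → ℕ}

theorem coeff_nahmTerm_of_ne {l : ℕ} (c : ι → ℕ) {m : ι → ℕ} (h : w ⬝ᵥ m ≠ l) :
    PowerSeries.coeff l (nahmTerm A d w c m) = 0 := by
  rw [nahmTerm, zVar, qVar, ← map_pow, mul_assoc, ← map_mul, PowerSeries.coeff_mul_C,
    PowerSeries.coeff_X_pow, if_neg h.symm, zero_mul]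

theorem hasSum_nahmSum (hw : ∀ i, 0 < w i) (c : ι → ℕ) :
    HasSum (nahmTerm A d w c) (nahmSum A d w c) := by
  classical
  refine Summable.hasSum ((PowerSeries.WithPiTopology.summable_iff_summable_coeff _).2 fun l => ?_)
  refine summable_of_ne_finset_zero (s := Fintype.piFinset fun _ => Finset.range (l + 1))
    fun m hm => coeff_nahmTerm_of_ne c fun h => hm ?_
  refine Fintype.mem_piFinset.2 fun i => Finset.mem_range_succ_iff.2 ?_
  calc m i ≤ w i * m i := Nat.le_mul_of_pos_left _ (hw i)
    _ ≤ w ⬝ᵥ m :=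
      Finset.single_le_sum (f := fun i => w i * m i) (fun _ _ => Nat.zero_le _) (Finset.mem_univ i)
    _ = l := h

theorem constantCoeff_nahmSum (hw : ∀ i, 0 < w i) (c : ι → ℕ) :
    PowerSeries.constantCoeff (nahmSum A d w c) = 1 := by
  have h := (hasSum_nahmSum (A := A) (d := d) hw c).map PowerSeries.constantCoeff
    (PowerSeries.WithPiTopology.continuous_constantCoeff ℤ⟦X⟧)
  refine h.unique ?_
  convert hasSum_single (0 : ι → ℕ) fun m hm => ?_
  · simp [nahmTerm, invQPoch_zero]
  · rw [Function.comp_apply, ← PowerSeries.coeff_zero_eq_constantCoeff_apply]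
    refine coeff_nahmTerm_of_ne c fun h => hm (funext fun i => ?_)
    have hi := Finset.sum_eq_zero_iff.1 h i (Finset.mem_univ i)
    exact (mul_eq_zero.1 hi).resolve_left (hw i).ne'

theorem rescale_nahmSum (hw : ∀ i, 0 < w i) (k : ℕ) (c : ι → ℕ) :
    PowerSeries.rescale (PowerSeries.X ^ k) (nahmSum A d w c) = nahmSum A d w (c + k • w) := by
  refine (hasSum_rescale _ (hasSum_nahmSum hw c)).unique
    ((hasSum_nahmSum hw _).congr_fun fun m => ?_)
  simp only [nahmTerm, map_mul, map_pow, rescale_zVar, rescale_qVar, rescale_C, add_dotProduct,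
    smul_dotProduct, smul_eq_mul]
  ring

variable [DecidableEq ι]

theorem dotProduct_mulVec_add_single (m : ι → ℕ) (i : ι) :
    (m + Pi.single i 1) ⬝ᵥ A.mulVec (m + Pi.single i 1) =
      m ⬝ᵥ A.mulVec m + (A.row i + A.col i) ⬝ᵥ m + A i i := by
  have hrow : A.mulVec m i = A.row i ⬝ᵥ m := rfl
  simp only [Matrix.mulVec_add, dotProduct_add, add_dotProduct, Matrix.mulVec_single_one,
    single_one_dotProduct, Matrix.col_apply, hrow, dotProduct_comm m (A.col i)]
  ring

theorem one_sub_mul_prod_invQPoch_add_single (hd : ∀ i, 0 < d i) (m : ι → ℕ) (i : ι) :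
    (1 - PowerSeries.X ^ (d i * (m i + 1))) * ∏ j, invQPoch (d j) ((m + Pi.single i 1 : ι → ℕ) j) =
      ∏ j, invQPoch (d j) (m j) := by
  rw [← Finset.mul_prod_erase _ _ (Finset.mem_univ i), ← mul_assoc, Pi.add_apply, Pi.single_eq_same,
    one_sub_mul_invQPoch_succ (hd i), ← Finset.mul_prod_erase _ _ (Finset.mem_univ i)]
  congr 1
  refine Finset.prod_congr rfl fun j hj => ?_
  rw [Pi.add_apply, Pi.single_eq_of_ne (Finset.ne_of_mem_erase hj), add_zero]

theorem nahmTerm_sub (c m : ι → ℕ) (i : ι) :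
    nahmTerm A d w c m - nahmTerm A d w (c + Pi.single i (d i)) m =
      zVar ^ (w ⬝ᵥ m) * qVar ^ (m ⬝ᵥ A.mulVec m + c ⬝ᵥ m) *
        PowerSeries.C ((1 - PowerSeries.X ^ (d i * m i)) * ∏ j, invQPoch (d j) (m j)) := by
  simp only [nahmTerm, add_dotProduct, single_dotProduct, map_mul, map_sub, map_one, map_pow, qVar]
  ring

theorem nahmSum_eq_add (hd : ∀ i, 0 < d i) (hw : ∀ i, 0 < w i) (c : ι → ℕ) (i : ι) :
    nahmSum A d w c = nahmSum A d w (c + Pi.single i (d i)) +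
      zVar ^ w i * qVar ^ (A i i + c i) * nahmSum A d w (c + (A.row i + A.col i)) := by
  have hdiff := (hasSum_nahmSum (A := A) (d := d) hw c).sub
    (hasSum_nahmSum (A := A) (d := d) hw (c + Pi.single i (d i)))
  rw [← sub_eq_iff_eq_add']
  refine (((add_left_injective (Pi.single i 1)).hasSum_iff fun m hm => ?_).2 hdiff).unique
    (((hasSum_nahmSum hw _).mul_left _).congr_fun fun m => ?_)
  · have hmi : m i = 0 := by
      by_contra hmi
      refine hm ⟨m - Pi.single i 1, tsub_add_cancel_of_le ?_⟩
      exact update_le_iff.2 ⟨Nat.one_le_iff_ne_zero.2 hmi, fun _ _ => Nat.zero_le _⟩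
    rw [nahmTerm_sub, hmi, mul_zero, pow_zero, sub_self, zero_mul, map_zero, mul_zero]
  · rw [Function.comp_apply, nahmTerm_sub, Pi.add_apply, Pi.single_eq_same,
      one_sub_mul_prod_invQPoch_add_single hd, dotProduct_mulVec_add_single, nahmTerm]
    simp only [dotProduct_add, dotProduct_single_one, add_dotProduct]
    ring

end NahmSum

namespace ColouredPartition

theorem prodMap_id_add_two_injective :
    Function.Injective (Prod.map id (· + 2) : Fin 3 × ℕ → Fin 3 × ℕ) :=
  Function.injective_id.prodMap (add_left_injective 2)

/-- The partition in three colours obtained from `p` by increasing all parts by `2` and adding `b`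
parts `1` of colour label `2` and `j 0`, `j 2` parts `2` of colour labels `1`, `3`. In terms of the
frequency array with weight `j`, this moves the array of `p` two columns to the right and puts new
boundary columns in front of it. -/
noncomputable def prepend (j : Fin 3 → ℕ) (b : ℕ) (p : ColouredPartition 3) :
    ColouredPartition 3 where
  freq := p.freq.mapDomain (Prod.map id (· + 2)) + Finsupp.single (1, 1) b +
    Finsupp.single (0, 2) (j 0) + Finsupp.single (2, 2) (j 2)
  freq_zero c := by
    rw [Finsupp.add_apply, Finsupp.add_apply, Finsupp.add_apply, Finsupp.mapDomain_of_notMem_range]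
    · simp
    · rintro ⟨⟨c', i⟩, h⟩
      simp at h

variable {j k : Fin 3 → ℕ} {b : ℕ} {p : ColouredPartition 3}

theorem arrayEntry_zero_zero : arrayEntry (n := 2) j p 0 0 = j 0 :=
  rfl

theorem arrayEntry_two_zero : arrayEntry (n := 2) j p 2 0 = j 2 :=
  zero_add _

theorem arrayEntry_natCast (c : Fin 3) (i : ℕ) :
    arrayEntry (n := 2) j p c i =
      p.freq (c, i) + (if c = 0 ∧ i = 0 then j 0 else 0) + (if c = 2 ∧ i = 0 then j 2 else 0) := by
  rcases Nat.eq_zero_or_pos i with rfl | hi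
  · fin_cases c <;> simp [arrayEntry, freq_zero, Fin.last]
  · have h : ((i : ℤ) ≠ -1) := by omega
    simp [arrayEntry, h, hi.ne']

theorem arrayEntry_one_natCast (i : ℕ) : arrayEntry (n := 2) j p 1 i = p.freq (1, i) := by
  rw [arrayEntry_natCast]
  simp

theorem freq_prepend_one (c : Fin 3) : (prepend j b p).freq (c, 1) = if c = 1 then b else 0 := by
  simp only [prepend, Finsupp.add_apply]
  rw [Finsupp.mapDomain_of_notMem_range]
  · simp [Finsupp.single_apply, eq_comm]
  · rintro ⟨⟨c', i⟩, h⟩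
    simp at h

theorem freq_prepend_add_two (c : Fin 3) (i : ℕ) :
    (prepend j b p).freq (c, i + 2) = arrayEntry (n := 2) j p c i := by
  have h := Finsupp.mapDomain_apply prodMap_id_add_two_injective p.freq (c, i)
  simp only [Prod.map_apply, id] at h
  rw [arrayEntry_natCast]
  simp [prepend, h, Finsupp.single_apply, Prod.mk.injEq, eq_comm]

theorem arrayEntry_prepend_add_two (c : Fin 3) (i : ℕ) :
    arrayEntry (n := 2) k (prepend j b p) c (i + 2 : ℕ) = arrayEntry (n := 2) j p c i := by
  rw [arrayEntry_natCast, freq_prepend_add_two]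
  simp

theorem length_prepend : (prepend j b p).length = b + (j 0 + j 2) + p.length := by
  simp only [length, prepend]
  repeat rw [Finsupp.sum_add_index' (fun _ => rfl) (fun _ _ _ => rfl)]
  rw [Finsupp.sum_mapDomain_index (fun _ => rfl) (fun _ _ _ => rfl)]
  repeat rw [Finsupp.sum_single_index rfl]
  ring

theorem size_prepend :
    (prepend j b p).size = b + 2 * (j 0 + j 2) + (p.size + 2 * p.length) := by
  simp only [size, length, prepend]
  repeat rw [Finsupp.sum_add_index' (fun _ => mul_zero _) (fun _ _ _ => mul_add _ _ _)]
  rw [Finsupp.sum_mapDomain_index (fun _ => mul_zero _) (fun _ _ _ => mul_add _ _ _)]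
  repeat rw [Finsupp.sum_single_index (mul_zero _)]
  simp only [Prod.map_snd, add_mul, Finsupp.sum, Finset.sum_add_distrib, Finset.mul_sum]
  ring

/-- The inverse of `prepend`: the parts greater than `2`, decreased by `2`. -/
noncomputable def tail (p : ColouredPartition 3) : ColouredPartition 3 where
  freq := (p.freq.comapDomain _ prodMap_id_add_two_injective.injOn).filter fun a => a.2 ≠ 0
  freq_zero _ := Finsupp.filter_apply_neg _ _ (not_not.2 rfl)

theorem freq_tail (c : Fin 3) (i : ℕ) :
    (tail p).freq (c, i) = if i = 0 then 0 else p.freq (c, i + 2) := by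
  rcases eq_or_ne i 0 with rfl | hi
  · exact freq_zero _ c
  · rw [if_neg hi]
    exact Finsupp.filter_apply_pos _ _ hi

theorem tail_prepend : tail (prepend j b p) = p := by
  refine ColouredPartition.ext (Finsupp.ext fun ⟨c, i⟩ => ?_)
  rcases eq_or_ne i 0 with rfl | hi
  · rw [freq_zero, freq_zero]
  · simp [freq_tail, freq_prepend_add_two, arrayEntry_natCast, hi]

/-- The parity condition on the parts in the definition of `dPartitions`. -/
def IsParityAdmissible (p : ColouredPartition 3) : Prop :=
  ∀ c i, p.freq (c, i) ≠ 0 → Odd (i + (c.val + 1))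

theorem prepend_tail (hp : p.IsParityAdmissible) (h₀ : j 0 = p.freq (0, 2))
    (h₂ : j 2 = p.freq (2, 2)) : prepend j (p.freq (1, 1)) (tail p) = p := by
  have hz : ∀ c i, ¬ Odd (i + (c.val + 1)) → p.freq (c, i) = 0 :=
    fun c i hc => not_not.1 fun h => hc (hp c i h)
  refine ColouredPartition.ext (Finsupp.ext fun ⟨c, i⟩ => ?_)
  match i with
  | 0 => rw [freq_zero, freq_zero]
  | 1 =>
    rw [freq_prepend_one]
    fin_cases c
    · exact (hz 0 1 (by decide)).symm
    · rfl
    · exact (hz 2 1 (by decide)).symm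
  | i + 2 =>
    rw [freq_prepend_add_two, arrayEntry_natCast, freq_tail]
    rcases eq_or_ne i 0 with rfl | hi
    · fin_cases c
      · simpa using h₀
      · simpa using (hz 1 2 (by decide)).symm
      · simpa using h₂
    · simp [hi]

theorem isParityAdmissible_prepend_iff :
    (prepend j b p).IsParityAdmissible ↔ p.IsParityAdmissible := by
  refine ⟨fun h c i hc => ?_, fun h c i hc => ?_⟩
  · have := h c (i + 2) (by rw [freq_prepend_add_two, arrayEntry_natCast]; omega)
    rw [Nat.odd_iff] at this ⊢
    omega
  · match i with
    | 0 => exact absurd (freq_zero _ c) hc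
    | 1 =>
      rw [freq_prepend_one, ne_eq, ite_eq_right_iff, Classical.not_imp] at hc
      rw [hc.1]
      decide
    | i + 2 =>
      rw [freq_prepend_add_two, arrayEntry_natCast] at hc
      by_cases hi : i = 0
      · subst hi
        fin_cases c
        · decide
        · simp [freq_zero] at hc
        · decide
      · have := h c i (by simpa [hi] using hc)
        rw [Nat.odd_iff] at this ⊢
        omega

/-- The largest sum of three entries along a path of the frequency array of `p` with weight `k`
whose middle entry is in column `2 m + 1`. -/
def maxPathSum (k : Fin 3 → ℕ) (p : ColouredPartition 3) (m : ℕ) : ℕ :=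
  p.freq (1, 2 * m + 1) +
    max (arrayEntry (n := 2) k p 0 (2 * m : ℕ)) (arrayEntry (n := 2) k p 0 (2 * m + 2 : ℕ)) +
    max (arrayEntry (n := 2) k p 2 (2 * m : ℕ)) (arrayEntry (n := 2) k p 2 (2 * m + 2 : ℕ))

theorem isPath_two_iff {i : Fin 3 → ℤ} :
    IsPath (n := 2) i ↔ i = ![0, -1, 0] ∨ ∃ m : ℕ, i 1 = (2 * m + 1 : ℕ) ∧
      (i 0 = (2 * m : ℕ) ∨ i 0 = (2 * m + 2 : ℕ)) ∧
      (i 2 = (2 * m : ℕ) ∨ i 2 = (2 * m + 2 : ℕ)) := by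
  have hpath : IsPath (n := 2) i ↔ (-1 ≤ i 0 ∧ -1 ≤ i 1 ∧ -1 ≤ i 2) ∧
      (i 0 % 2 = 0 ∧ i 1 % 2 = 1 ∧ i 2 % 2 = 0) ∧ |i 0 - i 1| = 1 ∧ |i 1 - i 2| = 1 := by
    have hodd : (∀ c : Fin 3, Odd (i c + ((c.val : ℤ) + 1))) ↔
        i 0 % 2 = 0 ∧ i 1 % 2 = 1 ∧ i 2 % 2 = 0 := by
      simp only [Fin.forall_fin_succ, IsEmpty.forall_iff, and_true, Int.odd_iff, Fin.val_zero,
        Fin.val_succ, Fin.succ_zero_eq_one, Fin.succ_one_eq_two]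
      omega
    have hstep : (∀ c d : Fin 3, c.val + 1 = d.val → |i c - i d| = 1) ↔
        |i 0 - i 1| = 1 ∧ |i 1 - i 2| = 1 := by
      simp [Fin.forall_fin_succ]
    have hle : (∀ c : Fin 3, -1 ≤ i c) ↔ -1 ≤ i 0 ∧ -1 ≤ i 1 ∧ -1 ≤ i 2 := by
      simp [Fin.forall_fin_succ]
    rw [← hle, ← hodd, ← hstep]
    exact ⟨fun h => ⟨h.1, h.2, h.3⟩, fun h => ⟨h.1, h.2.1, h.2.2⟩⟩
  rw [hpath, abs_eq zero_le_one, abs_eq zero_le_one]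
  refine ⟨fun h => ?_, ?_⟩
  · by_cases h₁ : i 1 = -1
    · refine Or.inl (funext fun c => ?_)
      fin_cases c <;> simp <;> omega
    · exact Or.inr ⟨(i 1 / 2).toNat, by omega⟩
  · rintro (rfl | ⟨m, h⟩)
    · simp
    · omega

theorem mem_dPartitions_two_iff :
    p ∈ dPartitions 2 k ↔ p.IsParityAdmissible ∧ ∀ m, maxPathSum k p m ≤ ∑ i, k i := by
  have hsum (i : Fin 3 → ℤ) : ∑ c, arrayEntry (n := 2) k p c (i c) =
      arrayEntry (n := 2) k p 0 (i 0) + arrayEntry (n := 2) k p 1 (i 1) +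
        arrayEntry (n := 2) k p 2 (i 2) :=
    Fin.sum_univ_three _
  refine and_congr_right fun _ => ⟨fun h m => ?_, fun h i hi => ?_⟩
  · have hpath (u v : ℤ) (hu : u = (2 * m : ℕ) ∨ u = (2 * m + 2 : ℕ))
        (hv : v = (2 * m : ℕ) ∨ v = (2 * m + 2 : ℕ)) :
        arrayEntry (n := 2) k p 0 u + p.freq (1, 2 * m + 1) + arrayEntry (n := 2) k p 2 v ≤
          ∑ i, k i := by
      rw [← arrayEntry_one_natCast]
      exact (hsum ![u, (2 * m + 1 : ℕ), v]).symm.trans_le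
        (h _ (isPath_two_iff.2 (.inr ⟨m, rfl, hu, hv⟩)))
    have h₁ := hpath _ _ (.inl rfl) (.inl rfl)
    have h₂ := hpath _ _ (.inl rfl) (.inr rfl)
    have h₃ := hpath _ _ (.inr rfl) (.inl rfl)
    have h₄ := hpath _ _ (.inr rfl) (.inr rfl)
    rw [maxPathSum]
    omega
  · rw [hsum]
    obtain rfl | ⟨m, h₁, h₀, h₂⟩ := isPath_two_iff.1 hi
    · have h₁ : arrayEntry (n := 2) k p 1 (-1) = k 1 := rfl
      simp [arrayEntry_zero_zero, h₁, arrayEntry_two_zero, Fin.sum_univ_three]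
    · refine le_trans ?_ (h m)
      rw [maxPathSum, h₁, arrayEntry_one_natCast]
      rcases h₀ with h₀ | h₀ <;> rcases h₂ with h₂ | h₂ <;> rw [h₀, h₂] <;> omega

theorem maxPathSum_prepend_zero :
    maxPathSum k (prepend j b p) 0 = b + max (k 0) (j 0) + max (k 2) (j 2) := by
  have h₁ : (prepend j b p).freq (1, 2 * 0 + 1) = b :=
    (freq_prepend_one 1).trans (if_pos rfl)
  rw [maxPathSum, h₁]
  simp only [arrayEntry_natCast, mul_zero, freq_prepend_add_two]
  simp [freq_zero]

theorem maxPathSum_prepend_succ (m : ℕ) :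
    maxPathSum k (prepend j b p) (m + 1) = maxPathSum j p m := by
  have h₁ : (prepend j b p).freq (1, 2 * (m + 1) + 1) = p.freq (1, 2 * m + 1) :=
    (freq_prepend_add_two 1 (2 * m + 1)).trans (arrayEntry_one_natCast _)
  rw [maxPathSum, h₁]
  simp only [mul_add, mul_one, arrayEntry_prepend_add_two, maxPathSum]

theorem prepend_mem_dPartitions_two_iff (h : ∑ i, j i = ∑ i, k i) :
    prepend j b p ∈ dPartitions 2 k ↔
      b + max (k 0) (j 0) + max (k 2) (j 2) ≤ ∑ i, k i ∧ p ∈ dPartitions 2 j := by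
  rw [mem_dPartitions_two_iff, mem_dPartitions_two_iff, isParityAdmissible_prepend_iff,
    ← Nat.and_forall_add_one, maxPathSum_prepend_zero, h, and_left_comm]
  simp only [maxPathSum_prepend_succ]

theorem prepend_inj {j' : Fin 3 → ℕ} {b' : ℕ} {p' : ColouredPartition 3}
    (hj : ∑ i, j i = ∑ i, j' i) (h : prepend j b p = prepend j' b' p') :
    j = j' ∧ b = b' ∧ p = p' := by
  have hfreq (c : Fin 3) (i : ℕ) :
      (prepend j b p).freq (c, i) = (prepend j' b' p').freq (c, i) := by
    rw [h]
  have hb : b = b' := by simpa [freq_prepend_one] using hfreq 1 1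
  have h₀ : j 0 = j' 0 := by
    simpa [freq_prepend_add_two, arrayEntry_zero_zero] using hfreq 0 (0 + 2)
  have h₂ : j 2 = j' 2 := by
    simpa [freq_prepend_add_two, arrayEntry_two_zero] using hfreq 2 (0 + 2)
  rw [Fin.sum_univ_three, Fin.sum_univ_three] at hj
  refine ⟨funext fun c => ?_, hb, ?_⟩
  · fin_cases c
    · exact h₀
    · change j 1 = j' 1
      omega
    · exact h₂
  · rw [← tail_prepend (j := j) (b := b) (p := p), h, tail_prepend]

theorem exists_prepend_eq (hp : p ∈ dPartitions 2 k) :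
    ∃ j b p', ∑ i, j i = ∑ i, k i ∧ prepend j b p' = p := by
  obtain ⟨hpar, hsum⟩ := mem_dPartitions_two_iff.1 hp
  have hle : p.freq (0, 2) + p.freq (2, 2) ≤ ∑ i, k i := by
    have h := hsum 0
    have h₀ : arrayEntry (n := 2) k p 0 (2 * 0 + 2 : ℕ) = p.freq (0, 2) := rfl
    have h₂ : arrayEntry (n := 2) k p 2 (2 * 0 + 2 : ℕ) = p.freq (2, 2) := rfl
    rw [maxPathSum, h₀, h₂] at h
    omega
  refine ⟨![p.freq (0, 2), ∑ i, k i - (p.freq (0, 2) + p.freq (2, 2)), p.freq (2, 2)], _, _, ?_,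
    prepend_tail hpar rfl rfl⟩
  rw [Fin.sum_univ_three]
  change p.freq (0, 2) + (∑ i, k i - (p.freq (0, 2) + p.freq (2, 2))) + p.freq (2, 2) = _
  omega

/-- The pairs `(j, b)` for which `prepend j b` maps `dPartitions 2 j` into `dPartitions 2 k`. -/
def heads (k : Fin 3 → ℕ) : Finset (Σ _ : Fin 3 → ℕ, ℕ) :=
  (Finset.Nat.antidiagonalTuple 3 (∑ i, k i)).sigma fun j =>
    Finset.range (∑ i, k i + 1 - (max (k 0) (j 0) + max (k 2) (j 2)))

theorem mem_heads_iff {t : Σ _ : Fin 3 → ℕ, ℕ} :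
    t ∈ heads k ↔ ∑ i, t.1 i = ∑ i, k i ∧
      t.2 + max (k 0) (t.1 0) + max (k 2) (t.1 2) ≤ ∑ i, k i := by
  rw [heads, Finset.mem_sigma, Finset.Nat.mem_antidiagonalTuple, Finset.mem_range]
  omega

/-- The decomposition of the partitions in `dPartitions 2 k` according to their parts `1` and `2`,
which are recorded by an element of `heads k`. -/
noncomputable def prependEquiv (k : Fin 3 → ℕ) :
    (Σ t : heads k, dPartitions 2 t.1.1) ≃ dPartitions 2 k :=
  Equiv.ofBijective
    (fun x => ⟨prepend x.1.1.1 x.1.1.2 x.2.1,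
      (prepend_mem_dPartitions_two_iff (mem_heads_iff.1 x.1.2).1).2
        ⟨(mem_heads_iff.1 x.1.2).2, x.2.2⟩⟩) <| by
    constructor
    · rintro ⟨⟨⟨j, b⟩, ht⟩, p, hp⟩ ⟨⟨⟨j', b'⟩, ht'⟩, p', hp'⟩ h
      obtain ⟨rfl, rfl, rfl⟩ := prepend_inj
        ((mem_heads_iff.1 ht).1.trans (mem_heads_iff.1 ht').1.symm) (congrArg Subtype.val h)
      rfl
    · rintro ⟨p, hp⟩
      obtain ⟨j, b, p, hj, rfl⟩ := exists_prepend_eq hp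
      obtain ⟨hb, hp'⟩ := (prepend_mem_dPartitions_two_iff hj).1 hp
      exact ⟨⟨⟨⟨j, b⟩, mem_heads_iff.2 ⟨hj, hb⟩⟩, ⟨p, hp'⟩⟩, rfl⟩

end ColouredPartition

/-- The generating function of the possible parts `1` and `2` of a partition in `dPartitions 2 k`
with `j 0` and `j 2` parts `2` of colour labels `1` and `3`. -/
noncomputable def transfer (k j : Fin 3 → ℕ) : ℤ⟦X⟧⟦X⟧ :=
  ∑ b ∈ Finset.range (∑ i, k i + 1 - (max (k 0) (j 0) + max (k 2) (j 2))),
    zVar ^ (b + (j 0 + j 2)) * qVar ^ (b + 2 * (j 0 + j 2))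

open ColouredPartition in
theorem dGenFun_two_eq_sum_transfer (k : Fin 3 → ℕ) :
    dGenFun 2 k = ∑ j ∈ Finset.Nat.antidiagonalTuple 3 (∑ i, k i),
      transfer k j * PowerSeries.rescale (PowerSeries.X ^ 2) (dGenFun 2 j) := by
  have hfiber (t : heads k) : HasSum
      (fun p : dPartitions 2 t.1.1 => zVar ^ (prependEquiv k ⟨t, p⟩).1.length *
        qVar ^ (prependEquiv k ⟨t, p⟩).1.size)
      (zVar ^ (t.1.2 + (t.1.1 0 + t.1.1 2)) * qVar ^ (t.1.2 + 2 * (t.1.1 0 + t.1.1 2)) *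
        PowerSeries.rescale (PowerSeries.X ^ 2) (dGenFun 2 t.1.1)) := by
    refine ((hasSum_rescale _ (hasSum_dGenFun 2 t.1.1)).mul_left _).congr_fun fun p => ?_
    change zVar ^ (prepend t.1.1 t.1.2 p.1).length * qVar ^ (prepend t.1.1 t.1.2 p.1).size = _
    rw [length_prepend, size_prepend, map_mul, map_pow, map_pow, rescale_zVar, rescale_qVar]
    ring
  have hsum := ((prependEquiv k).hasSum_iff.2 (hasSum_dGenFun 2 k)).sigma hfiber
  rw [hsum.unique (hasSum_fintype _), Finset.sum_coe_sort (heads k) fun t =>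
    zVar ^ (t.2 + (t.1 0 + t.1 2)) * qVar ^ (t.2 + 2 * (t.1 0 + t.1 2)) *
      PowerSeries.rescale (PowerSeries.X ^ 2) (dGenFun 2 t.1), heads, Finset.sum_sigma]
  simp only [transfer, Finset.sum_mul]

open ColouredPartition in
theorem constantCoeff_dGenFun_two (k : Fin 3 → ℕ) :
    PowerSeries.constantCoeff (dGenFun 2 k) = 1 := by
  have h := (hasSum_dGenFun 2 k).map PowerSeries.constantCoeff
    (PowerSeries.WithPiTopology.continuous_constantCoeff ℤ⟦X⟧)
  let empty : ColouredPartition 3 := ⟨0, fun _ => rfl⟩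
  have hmem : empty ∈ dPartitions 2 k := by
    refine mem_dPartitions_two_iff.2 ⟨fun _ _ h => absurd rfl h, fun m => ?_⟩
    have h₀ (i : ℕ) : arrayEntry (n := 2) k empty 0 i ≤ k 0 := by
      by_cases hi : i = 0 <;> simp [arrayEntry_natCast, arrayEntry_zero_zero, empty, hi]
    have h₂ (i : ℕ) : arrayEntry (n := 2) k empty 2 i ≤ k 2 := by
      by_cases hi : i = 0 <;> simp [arrayEntry_natCast, arrayEntry_two_zero, empty, hi]
    rw [Fin.sum_univ_three]
    calc maxPathSum k empty m ≤ 0 + k 0 + k 2 := by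
          rw [maxPathSum]
          gcongr
          · rfl
          · exact max_le (h₀ _) (h₀ _)
          · exact max_le (h₂ _) (h₂ _)
      _ ≤ k 0 + k 1 + k 2 := by omega
  refine h.unique ?_
  convert hasSum_single (⟨empty, hmem⟩ : dPartitions 2 k) fun p hp => ?_
  · simp [empty, ColouredPartition.length, ColouredPartition.size]
  · have hlen : p.1.length ≠ 0 := fun h => hp <| Subtype.ext <| ColouredPartition.ext <|
      (Finsupp.degree_eq_zero_iff _).1 h
    simp [zVar, hlen]

theorem constantCoeff_transfer {K : ℕ} (k : Fin 3 → ℕ) {j : Fin 3 → ℕ} (hj : ∑ i, j i = K) :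
    PowerSeries.constantCoeff (transfer k j) = if j = ![0, K, 0] then 1 else 0 := by
  have hiff : j = ![0, K, 0] ↔ j 0 + j 2 = 0 := by
    rw [Fin.sum_univ_three] at hj
    refine ⟨by rintro rfl; rfl, fun h => funext fun c => ?_⟩
    fin_cases c <;> simp <;> omega
  rw [transfer, map_sum]
  simp only [hiff]
  by_cases h : j 0 + j 2 = 0
  · have hmem : 0 ∈ Finset.range (∑ i, k i + 1 - (max (k 0) (j 0) + max (k 2) (j 2))) := by
      rw [Finset.mem_range, Fin.sum_univ_three]
      omega
    rw [if_pos h, Finset.sum_eq_single_of_mem 0 hmem fun b _ hb => by simp [zVar, hb]]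
    simp [h]
  · rw [if_neg h]
    refine Finset.sum_eq_zero fun b _ => ?_
    have hb : b + (j 0 + j 2) ≠ 0 := by omega
    rw [map_mul, map_pow, zVar, PowerSeries.constantCoeff_X, zero_pow hb, zero_mul]

theorem coeff_mul_rescale_of_forall_lt {R : Type*} [CommSemiring R] {f g : R⟦X⟧} {l : ℕ}
    (a : R) (h : ∀ m < l, PowerSeries.coeff m g = 0) :
    PowerSeries.coeff l (f * PowerSeries.rescale a g) =
      PowerSeries.constantCoeff f * (a ^ l * PowerSeries.coeff l g) := by
  rw [PowerSeries.coeff_mul, Finset.sum_eq_single (0, l)]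
  · rw [PowerSeries.coeff_zero_eq_constantCoeff_apply, PowerSeries.coeff_rescale]
  · intro x hx hne
    rw [Finset.HasAntidiagonal.mem_antidiagonal] at hx
    have hlt : x.2 < l := by
      refine lt_of_le_of_ne (by omega) fun hl => hne (Prod.ext ?_ hl)
      change x.1 = 0
      omega
    rw [PowerSeries.coeff_rescale, h _ hlt, mul_zero, mul_zero]
  · intro hl
    simp at hl

theorem eq_of_eq_sum_rescale {R ι : Type*} [CommRing R] [IsDomain R] [Fintype ι] [DecidableEq ι]
    {a : R} (ha : ∀ l ≠ 0, a ^ l ≠ 1) {i₀ : ι} {T : ι → ι → R⟦X⟧}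
    (hT : ∀ i j, PowerSeries.constantCoeff (T i j) = if j = i₀ then 1 else 0) {F G : ι → R⟦X⟧}
    (hF : ∀ i, F i = ∑ j, T i j * PowerSeries.rescale a (F j))
    (hG : ∀ i, G i = ∑ j, T i j * PowerSeries.rescale a (G j))
    (h₀ : PowerSeries.constantCoeff (F i₀) = PowerSeries.constantCoeff (G i₀)) : F = G := by
  have hH (i : ι) : F i - G i = ∑ j, T i j * PowerSeries.rescale a (F j - G j) := by
    simp only [map_sub, mul_sub, Finset.sum_sub_distrib, ← hF, ← hG]
  suffices h : ∀ l i, PowerSeries.coeff l (F i - G i) = 0 from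
    funext fun i => sub_eq_zero.1 (PowerSeries.ext fun l => h l i)
  intro l
  induction l using Nat.strong_induction_on with
  | _ l ih =>
    have hcoeff (i : ι) : PowerSeries.coeff l (F i - G i) =
        a ^ l * PowerSeries.coeff l (F i₀ - G i₀) := by
      rw [hH i, map_sum, Finset.sum_congr rfl fun j _ =>
        coeff_mul_rescale_of_forall_lt a fun m hm => ih m hm j]
      simp [hT]
    have hzero : PowerSeries.coeff l (F i₀ - G i₀) = 0 := by
      rcases eq_or_ne l 0 with rfl | hl
      · rw [PowerSeries.coeff_zero_eq_constantCoeff_apply, map_sub, h₀, sub_self]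
      · exact (mul_left_eq_self₀.1 (hcoeff i₀).symm).resolve_left (ha l hl)
    intro i
    rw [hcoeff, hzero, mul_zero]

theorem eq_dGenFun_two {K : ℕ} {G : (Fin 3 → ℕ) → ℤ⟦X⟧⟦X⟧}
    (hG : ∀ k ∈ Finset.Nat.antidiagonalTuple 3 K, G k = ∑ j ∈ Finset.Nat.antidiagonalTuple 3 K,
      transfer k j * PowerSeries.rescale (PowerSeries.X ^ 2) (G j))
    (h₀ : PowerSeries.constantCoeff (G ![0, K, 0]) = 1) {k : Fin 3 → ℕ} (hk : ∑ i, k i = K) :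
    G k = dGenFun 2 k := by
  have hsum (j : Finset.Nat.antidiagonalTuple 3 K) : ∑ i, j.1 i = K :=
    Finset.Nat.mem_antidiagonalTuple.1 j.2
  have hX (l : ℕ) (hl : l ≠ 0) : ((PowerSeries.X : ℤ⟦X⟧) ^ 2) ^ l ≠ 1 := by
    intro h
    simpa [hl] using congrArg PowerSeries.constantCoeff h
  have hmem : ![0, K, 0] ∈ Finset.Nat.antidiagonalTuple 3 K := by
    simp [Finset.Nat.mem_antidiagonalTuple, Fin.sum_univ_three]
  refine congrFun (eq_of_eq_sum_rescale hX (i₀ := ⟨_, hmem⟩)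
    (T := fun k j : Finset.Nat.antidiagonalTuple 3 K => transfer k j)
    (F := fun j => G j) (G := fun j => dGenFun 2 j) (fun i j => ?_) (fun i => ?_) (fun i => ?_) ?_)
    ⟨k, Finset.Nat.mem_antidiagonalTuple.2 hk⟩
  · simp only [constantCoeff_transfer _ (hsum j), Subtype.ext_iff]
  · rw [hG i i.2, ← Finset.sum_coe_sort]
  · rw [dGenFun_two_eq_sum_transfer, hsum i, ← Finset.sum_coe_sort]
  · rw [h₀, constantCoeff_dGenFun_two]

section LevelTwoSum

/-- The Nahm sum obtained from the quadruple sum of the theorem by the substitution `r₁ = m₁ + m₂`,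
`r₂ = m₂`, `s₁ = n₁`, `s₂ = n₁ + n₂`, with linear term `c₁ m₁ + c₂ m₂ + c₃ n₁ + c₄ n₂`. -/
noncomputable def levelTwoSum (c₁ c₂ c₃ c₄ : ℕ) : ℤ⟦X⟧⟦X⟧ :=
  nahmSum !![1, 1, 1, 0; 1, 2, 2, 1; 1, 2, 4, 2; 0, 1, 2, 2] ![1, 1, 2, 2] ![1, 2, 2, 1]
    ![c₁, c₂, c₃, c₄]

local notation "S" => levelTwoSum
local notation "z" => zVar
local notation "q" => qVar

theorem constantCoeff_levelTwoSum (c₁ c₂ c₃ c₄ : ℕ) :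
    PowerSeries.constantCoeff (S c₁ c₂ c₃ c₄) = 1 :=
  constantCoeff_nahmSum (by decide) _

theorem rescale_levelTwoSum (c₁ c₂ c₃ c₄ : ℕ) :
    PowerSeries.rescale (PowerSeries.X ^ 2) (S c₁ c₂ c₃ c₄) =
      S (c₁ + 2) (c₂ + 4) (c₃ + 4) (c₄ + 2) := by
  rw [levelTwoSum, rescale_nahmSum (by decide), levelTwoSum]
  simp

theorem levelTwoSum_eq_add₁ (c₁ c₂ c₃ c₄ : ℕ) :
    S c₁ c₂ c₃ c₄ = S (c₁ + 1) c₂ c₃ c₄ + z * q ^ (1 + c₁) * S (c₁ + 2) (c₂ + 2) (c₃ + 2) c₄ := by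
  rw [levelTwoSum, nahmSum_eq_add (by decide) (by decide) _ 0, levelTwoSum, levelTwoSum]
  congr! 3
  · ext j
    fin_cases j <;> rfl
  · exact pow_one z
  · ext j
    fin_cases j <;> rfl

theorem levelTwoSum_eq_add₂ (c₁ c₂ c₃ c₄ : ℕ) :
    S c₁ c₂ c₃ c₄ =
      S c₁ (c₂ + 1) c₃ c₄ + z ^ 2 * q ^ (2 + c₂) * S (c₁ + 2) (c₂ + 4) (c₃ + 4) (c₄ + 2) := by
  rw [levelTwoSum, nahmSum_eq_add (by decide) (by decide) _ 1, levelTwoSum, levelTwoSum]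
  congr! 3 <;> ext j <;> fin_cases j <;> rfl

theorem levelTwoSum_eq_add₃ (c₁ c₂ c₃ c₄ : ℕ) :
    S c₁ c₂ c₃ c₄ =
      S c₁ c₂ (c₃ + 2) c₄ + z ^ 2 * q ^ (4 + c₃) * S (c₁ + 2) (c₂ + 4) (c₃ + 8) (c₄ + 4) := by
  rw [levelTwoSum, nahmSum_eq_add (by decide) (by decide) _ 2, levelTwoSum, levelTwoSum]
  congr! 3 <;> ext j <;> fin_cases j <;> rfl

theorem levelTwoSum_eq_add₄ (c₁ c₂ c₃ c₄ : ℕ) :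
    S c₁ c₂ c₃ c₄ =
      S c₁ c₂ c₃ (c₄ + 2) + z * q ^ (2 + c₄) * S c₁ (c₂ + 2) (c₃ + 4) (c₄ + 4) := by
  rw [levelTwoSum, nahmSum_eq_add (by decide) (by decide) _ 3, levelTwoSum, levelTwoSum]
  congr! 3
  · ext j
    fin_cases j <;> rfl
  · exact pow_one z
  · ext j
    fin_cases j <;> rfl

/-- The sums of the theorem as a function of the outer boundary values `(k₀, k₂)` of a weight of
level `2`; only the arguments with `k₀ + k₂ ≤ 2` are meaningful. -/
noncomputable def boundarySum : ℕ → ℕ → ℤ⟦X⟧⟦X⟧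
  | 0, 0 => S 0 0 0 0
  | 1, 1 => S 1 2 2 2 + z * q ^ 2 * S 2 4 6 4
  | 1, 0 | 0, 1 => S 0 1 2 2 + z * q ^ 2 * S 1 3 6 4
  | _, _ => S 1 2 4 2

local notation "V" => boundarySum
local notation "U" => fun a b => PowerSeries.rescale (PowerSeries.X ^ 2) (boundarySum a b)

theorem rescale_boundarySum_zero_zero : U 0 0 = S 2 4 4 2 :=
  rescale_levelTwoSum 0 0 0 0

theorem rescale_boundarySum_one_zero : U 1 0 = S 2 5 6 4 + z * q ^ 4 * S 3 7 10 6 := by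
  simp only [boundarySum, map_add, map_mul, map_pow, rescale_levelTwoSum, rescale_zVar,
    rescale_qVar]
  ring

theorem rescale_boundarySum_one_one : U 1 1 = S 3 6 6 4 + z * q ^ 4 * S 4 8 10 6 := by
  simp only [boundarySum, map_add, map_mul, map_pow, rescale_levelTwoSum, rescale_zVar,
    rescale_qVar]
  ring

theorem rescale_boundarySum_two_zero : U 2 0 = S 3 6 8 4 :=
  rescale_levelTwoSum 1 2 4 2

theorem levelTwoSum_one_three_four_two : S 1 3 4 2 = U 0 0 + z * q ^ 2 * U 1 0 := by
  rw [rescale_boundarySum_zero_zero, rescale_boundarySum_one_zero]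
  calc S 1 3 4 2 = S 2 3 4 2 + z * q ^ 2 * S 3 5 6 2 := levelTwoSum_eq_add₁ 1 3 4 2
    _ = S 2 4 4 2 + z ^ 2 * q ^ 5 * S 4 7 8 4
          + z * q ^ 2 * (S 3 5 6 4 + z * q ^ 4 * S 3 7 10 6) := by
      rw [levelTwoSum_eq_add₂ 2 3, levelTwoSum_eq_add₄ 3 5 6 2]
    _ = S 2 4 4 2 + z * q ^ 2 * (S 3 5 6 4 + z * q ^ 3 * S 4 7 8 4
          + z * q ^ 4 * S 3 7 10 6) := by ring
    _ = S 2 4 4 2 + z * q ^ 2 * (S 2 5 6 4 + z * q ^ 4 * S 3 7 10 6) := by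
      rw [← levelTwoSum_eq_add₁ 2 5 6 4]

theorem boundarySum_two_zero : V 2 0 = S 1 3 4 2 + z ^ 2 * q ^ 4 * U 2 0 := by
  rw [rescale_boundarySum_two_zero]
  exact levelTwoSum_eq_add₂ 1 2 4 2

theorem boundarySum_one_one :
    V 1 1 = S 1 3 4 2 + z * q ^ 2 * U 1 0 + z ^ 2 * q ^ 4 * U 1 1 := by
  rw [rescale_boundarySum_one_zero, rescale_boundarySum_one_one]
  calc
    S 1 2 2 2 + z * q ^ 2 * S 2 4 6 4
      = S 1 3 2 2 + z ^ 2 * q ^ 4 * S 3 6 6 4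
          + z * q ^ 2 * (S 2 5 6 4 + z ^ 2 * q ^ 6 * S 4 8 10 6) := by
      rw [levelTwoSum_eq_add₂ 1 2, levelTwoSum_eq_add₂ 2 4]
    _ = S 1 3 4 2 + z ^ 2 * q ^ 6 * S 3 7 10 6 + z ^ 2 * q ^ 4 * S 3 6 6 4
          + z * q ^ 2 * (S 2 5 6 4 + z ^ 2 * q ^ 6 * S 4 8 10 6) := by
      rw [levelTwoSum_eq_add₃ 1 3 2]
    _ = S 1 3 4 2 + z * q ^ 2 * (S 2 5 6 4 + z * q ^ 4 * S 3 7 10 6)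
          + z ^ 2 * q ^ 4 * (S 3 6 6 4 + z * q ^ 4 * S 4 8 10 6) := by ring

theorem boundarySum_one_zero :
    V 1 0 = V 1 1 + z * q * S 1 3 4 2 + z ^ 2 * q ^ 4 * U 2 0 := by
  rw [rescale_boundarySum_two_zero]
  calc
    S 0 1 2 2 + z * q ^ 2 * S 1 3 6 4
      = S 1 2 2 2 + z ^ 2 * q ^ 3 * S 3 5 6 4 + z * q * S 2 3 4 2
          + z * q ^ 2 * (S 2 4 6 4 + z * q ^ 2 * S 3 6 8 4 + z ^ 2 * q ^ 5 * S 3 7 10 6) := by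
      rw [levelTwoSum_eq_add₁ 0 1, levelTwoSum_eq_add₂ 1 1, levelTwoSum_eq_add₂ 1 3 6,
        levelTwoSum_eq_add₁ 1 4, pow_one]
    _ = S 1 2 2 2 + z * q ^ 2 * S 2 4 6 4
          + z * q * (S 2 3 4 2 + z * q ^ 2 * (S 3 5 6 4 + z * q ^ 4 * S 3 7 10 6))
          + z ^ 2 * q ^ 4 * S 3 6 8 4 := by ring
    _ = S 1 2 2 2 + z * q ^ 2 * S 2 4 6 4 + z * q * S 1 3 4 2 + z ^ 2 * q ^ 4 * S 3 6 8 4 := by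
      rw [← levelTwoSum_eq_add₄ 3 5 6 2, ← levelTwoSum_eq_add₁ 1 3 4 2]

theorem levelTwoSum_two_three_two_zero_add :
    S 2 3 2 0 + z * q ^ 2 * S 3 5 4 2 =
      S 2 3 4 2 + z * q ^ 2 * S 3 5 6 2 + z * q ^ 2 * U 1 0 := by
  rw [rescale_boundarySum_one_zero]
  calc
    S 2 3 2 0 + z * q ^ 2 * S 3 5 4 2
      = S 2 3 2 2 + z * q ^ 2 * S 3 5 4 2 + z * q ^ 2 * S 2 5 6 4 := by
      rw [levelTwoSum_eq_add₄ 2 3 2 0]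
      ring
    _ = S 1 3 4 2 + z ^ 2 * q ^ 6 * S 3 7 10 6 + z * q ^ 2 * S 2 5 6 4 := by
      rw [← levelTwoSum_eq_add₁ 1 3 2, levelTwoSum_eq_add₃ 1 3 2]
    _ = S 2 3 4 2 + z * q ^ 2 * S 3 5 6 2
          + z * q ^ 2 * (S 2 5 6 4 + z * q ^ 4 * S 3 7 10 6) := by
      rw [levelTwoSum_eq_add₁ 1 3 4]
      ring

theorem boundarySum_zero_zero :
    V 0 0 = V 1 0 + z ^ 2 * q ^ 2 * U 0 0 + z * q * (z * q ^ 2 * U 1 0)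
      + z ^ 2 * q ^ 4 * U 2 0 := by
  rw [rescale_boundarySum_two_zero, rescale_boundarySum_zero_zero]
  calc
    S 0 0 0 0
      = S 1 2 2 0 + z ^ 2 * q ^ 4 * S 3 6 8 4 + z ^ 2 * q ^ 3 * S 3 5 4 2
          + z * q * S 2 3 2 0 + z ^ 2 * q ^ 2 * S 2 4 4 2 := by
      rw [levelTwoSum_eq_add₂ 0 0, levelTwoSum_eq_add₁ 0 1, levelTwoSum_eq_add₂ 1 1,
        levelTwoSum_eq_add₃ 1 2 0, pow_one]
    _ = S 1 2 2 0 + z * q * (S 2 3 2 0 + z * q ^ 2 * S 3 5 4 2)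
          + z ^ 2 * q ^ 2 * S 2 4 4 2 + z ^ 2 * q ^ 4 * S 3 6 8 4 := by ring
    _ = S 1 2 2 0 + z ^ 2 * q ^ 3 * S 3 5 6 2 + z * q * S 2 3 4 2 + z ^ 2 * q ^ 2 * S 2 4 4 2
          + z * q * (z * q ^ 2 * U 1 0) + z ^ 2 * q ^ 4 * S 3 6 8 4 := by
      rw [levelTwoSum_two_three_two_zero_add]
      ring
    _ = S 1 1 2 2 + z * q ^ 2 * S 1 3 6 4 + z * q * S 2 3 4 2 + z ^ 2 * q ^ 2 * S 2 4 4 2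
          + z * q * (z * q ^ 2 * U 1 0) + z ^ 2 * q ^ 4 * S 3 6 8 4 := by
      rw [← levelTwoSum_eq_add₂ 1 1 2 0, levelTwoSum_eq_add₄ 1 1 2 0]
    _ = S 1 1 2 2 + z * q ^ 1 * S 2 3 4 2 + z * q ^ 2 * S 1 3 6 4 + z ^ 2 * q ^ 2 * S 2 4 4 2
          + z * q * (z * q ^ 2 * U 1 0) + z ^ 2 * q ^ 4 * S 3 6 8 4 := by ring
    _ = S 0 1 2 2 + z * q ^ 2 * S 1 3 6 4 + z ^ 2 * q ^ 2 * S 2 4 4 2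
          + z * q * (z * q ^ 2 * U 1 0) + z ^ 2 * q ^ 4 * S 3 6 8 4 := by
      rw [← levelTwoSum_eq_add₁ 0 1 2 2]

/-- The summand indexed by `(r₁, r₂, s₁, s₂)` of the multisum with linear exponent
`(a₁ r₁ + b₁ s₁) + (a₂ r₂ + b₂ s₂)`. -/
noncomputable def multisumTerm (a₁ a₂ b₁ b₂ : ℕ) : ℕ × ℕ × ℕ × ℕ → ℤ⟦X⟧⟦X⟧ :=
  fun (r₁, r₂, s₁, s₂) =>
    multisumFactor r₁ s₁ (a₁ * r₁ + b₁ * s₁) ((r₁ : ℤ) - r₂) ((s₁ : ℤ) - 0) *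
      multisumFactor r₂ s₂ (a₂ * r₂ + b₂ * s₂) ((r₂ : ℤ) - 0) ((s₂ : ℤ) - s₁)

theorem hasSum_multisumTerm (a₁ a₂ b₁ b₂ : ℕ) :
    HasSum (multisumTerm a₁ a₂ b₁ b₂) (S a₁ (a₁ + a₂) (b₁ + b₂) b₂) := by
  let e : (Fin 4 → ℕ) → ℕ × ℕ × ℕ × ℕ := fun m => (m 0 + m 1, m 1, m 2, m 2 + m 3)
  have he : Function.Injective e := by
    intro m m' h
    simp only [e, Prod.mk.injEq] at h
    ext i
    fin_cases i <;> simp <;> omega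
  refine (he.hasSum_iff fun ⟨r₁, r₂, s₁, s₂⟩ hx => ?_).1
    ((hasSum_nahmSum (by decide) _).congr_fun fun m => ?_)
  · have hlt : r₁ < r₂ ∨ s₂ < s₁ := by
      by_contra! h
      exact hx ⟨![r₁ - r₂, r₂, s₁, s₂ - s₁], by simp [e, h.1, h.2]⟩
    rcases hlt with h | h <;>
      simp [multisumTerm, multisumFactor, invQPoch_of_neg _ (sub_neg.2 (Nat.cast_lt.2 h))]
  · simp [e, multisumTerm, multisumFactor, nahmTerm, qVar, Fin.prod_univ_four, dotProduct,
      Matrix.mulVec, Fin.sum_univ_four]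
    ring

theorem boundarySum_eq_sum_transfer {k : Fin 3 → ℕ}
    (hk : k ∈ Finset.Nat.antidiagonalTuple 3 2) :
    V (k 0) (k 2) = ∑ j ∈ Finset.Nat.antidiagonalTuple 3 2, transfer k j * U (j 0) (j 2) := by
  have hS := levelTwoSum_one_three_four_two
  have h₂₀ : V 2 0 = U 0 0 + z * q ^ 2 * U 1 0 + (z * q ^ 2) ^ 2 * U 2 0 := by
    linear_combination boundarySum_two_zero + hS
  have h₁₁ : V 1 1 = U 0 0 + 2 * (z * q ^ 2) * U 1 0 + (z * q ^ 2) ^ 2 * U 1 1 := by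
    linear_combination boundarySum_one_one + hS
  have h₁₀ : V 1 0 = (1 + z * q) * U 0 0 + (2 + z * q) * (z * q ^ 2) * U 1 0 +
      (z * q ^ 2) ^ 2 * (U 2 0 + U 1 1) := by
    linear_combination boundarySum_one_zero + h₁₁ + z * q * hS
  have h₀₀ : V 0 0 = (1 + z * q + (z * q) ^ 2) * U 0 0 + (2 + 2 * (z * q)) * (z * q ^ 2) * U 1 0 +
      (z * q ^ 2) ^ 2 * (2 * U 2 0 + U 1 1) := by
    linear_combination boundarySum_zero_zero + h₁₀
  have h₀₁ : V 0 1 = V 1 0 := rfl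
  have h₀₂ : V 0 2 = V 2 0 := rfl
  have hlevel : Finset.Nat.antidiagonalTuple 3 2 =
      {![0, 0, 2], ![0, 1, 1], ![0, 2, 0], ![1, 0, 1], ![1, 1, 0], ![2, 0, 0]} := by decide
  rw [hlevel] at hk
  rw [hlevel]
  simp only [Finset.mem_insert, Finset.mem_singleton] at hk
  rcases hk with rfl | rfl | rfl | rfl | rfl | rfl <;>
    simp [transfer, Finset.sum_range_succ, Fin.sum_univ_three, h₀₁, h₀₂]
  · linear_combination h₂₀
  · linear_combination h₁₀
  · linear_combination h₀₀
  · linear_combination h₁₁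
  · linear_combination h₁₀
  · linear_combination h₂₀

theorem hasSum_multisumTerm_mul (a₁ a₂ b₁ b₂ : ℕ) :
    HasSum (fun x : ℕ × ℕ × ℕ × ℕ => multisumTerm a₁ a₂ b₁ b₂ x *
        (1 + z * q ^ (2 + ((x.1 + 2 * x.2.2.1) + (x.2.1 + 2 * x.2.2.2)))))
      (S a₁ (a₁ + a₂) (b₁ + b₂) b₂ +
        z * q ^ 2 * S (a₁ + 1) (a₁ + 1 + (a₂ + 1)) (b₁ + 2 + (b₂ + 2)) (b₂ + 2)) := by
  refine ((hasSum_multisumTerm a₁ a₂ b₁ b₂).add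
    ((hasSum_multisumTerm (a₁ + 1) (a₂ + 1) (b₁ + 2) (b₂ + 2)).mul_left _)).congr_fun fun x => ?_
  simp only [multisumTerm, multisumFactor]
  ring

end LevelTwoSum

/-- The four multisum formulas for `𝒟^{(2)}_Λ(z, q)`, with `Λ` equal to `2Λ_0`, `2Λ_1`, `Λ_0 + Λ_1`
and `Λ_0 + Λ_2`. Each sum over `r₁, r₂, s₁, s₂ ≥ 0` converges coefficientwise, and
`r₃ = s₀ = 0`. -/
theorem mainTheorem4 :
    HasSum (fun ((r₁, r₂, s₁, s₂) : ℕ × ℕ × ℕ × ℕ) =>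
        multisumFactor r₁ s₁ (r₁ + 2 * s₁) ((r₁ : ℤ) - r₂) ((s₁ : ℤ) - 0) *
          multisumFactor r₂ s₂ (r₂ + 2 * s₂) ((r₂ : ℤ) - 0) ((s₂ : ℤ) - s₁))
      (dGenFun 2 ![2, 0, 0]) ∧
    HasSum (fun ((r₁, r₂, s₁, s₂) : ℕ × ℕ × ℕ × ℕ) =>
        multisumFactor r₁ s₁ 0 ((r₁ : ℤ) - r₂) ((s₁ : ℤ) - 0) *
          multisumFactor r₂ s₂ 0 ((r₂ : ℤ) - 0) ((s₂ : ℤ) - s₁))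
      (dGenFun 2 ![0, 2, 0]) ∧
    HasSum (fun ((r₁, r₂, s₁, s₂) : ℕ × ℕ × ℕ × ℕ) =>
        multisumFactor r₁ s₁ 0 ((r₁ : ℤ) - r₂) ((s₁ : ℤ) - 0) *
          multisumFactor r₂ s₂ (r₂ + 2 * s₂) ((r₂ : ℤ) - 0) ((s₂ : ℤ) - s₁) *
          (1 + zVar * qVar ^ (2 + ((r₁ + 2 * s₁) + (r₂ + 2 * s₂)))))
      (dGenFun 2 ![1, 1, 0]) ∧
    HasSum (fun ((r₁, r₂, s₁, s₂) : ℕ × ℕ × ℕ × ℕ) =>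
        multisumFactor r₁ s₁ r₁ ((r₁ : ℤ) - r₂) ((s₁ : ℤ) - 0) *
          multisumFactor r₂ s₂ (r₂ + 2 * s₂) ((r₂ : ℤ) - 0) ((s₂ : ℤ) - s₁) *
          (1 + zVar * qVar ^ (2 + ((r₁ + 2 * s₁) + (r₂ + 2 * s₂)))))
      (dGenFun 2 ![1, 0, 1]) := by
  have hV {k : Fin 3 → ℕ} (hk : ∑ i, k i = 2) : dGenFun 2 k = boundarySum (k 0) (k 2) :=
    (eq_dGenFun_two (fun _ => boundarySum_eq_sum_transfer) (constantCoeff_levelTwoSum 0 0 0 0)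
      hk).symm
  refine ⟨?_, ?_, ?_, ?_⟩
  · rw [hV rfl]
    exact (hasSum_multisumTerm 1 1 2 2).congr_fun fun _ => by simp [multisumTerm]
  · rw [hV rfl]
    exact (hasSum_multisumTerm 0 0 0 0).congr_fun fun _ => by simp [multisumTerm]
  · rw [hV rfl]
    exact (hasSum_multisumTerm_mul 0 1 0 2).congr_fun fun _ => by simp [multisumTerm]
  · rw [hV rfl]
    exact (hasSum_multisumTerm_mul 1 1 0 2).congr_fun fun _ => by simp [multisumTerm]
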